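/- Oracles and languages are sets of binary strings. For an oracle $A$, let $\mathbf{P}^A$ (resp. $\mathbf{NP}^A$) be the class of languages decided by deterministic (resp. nondeterministic) polynomial-time Turing machines with oracle $A$, and let $\mathbf{coNP}^A$ be the class of languages whose complement is in $\mathbf{NP}^A$. Put $$\mathbf{O}=\{A : \mathbf{P}^A\neq\mathbf{NP}^A\},\qquad \mathbf{O}'=\{A : \mathbf{NP}^A\neq\mathbf{coNP}^A\}.$$ Fix an enumeration (a bijection of $\omega$ with the set of binary strings), and use it to identify infinite oracles with elements of the set $[\omega]^\omega$ of infinite subsets of $\omega$. The Ellentuck topology on $[\omega]^\omega$ has as basic open sets the sets $[a,A]=\{S\in[\omega]^\omega : S\setminus A=a \text{ and } S\setminus a\subseteq A\}$, where $a\subseteq\omega$ is finite and $A\subseteq\omega\setminus a$ is infinite. A subset of $[\omega]^\omega$ is called Ramsey positive if it is not meager in the Ellentuck topology. Theorem. (1) The set of infinite oracles in $\mathbf{O}'$ is Ramsey positive. (2) There is an infinite set $H$ of binary strings such that $\mathbf{NP}^K\neq\mathbf{coNP}^K$ for every infinite $K\subseteq H$. (3) $\mathbf{O}'\subseteq\mathbf{O}$,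 and the set of infinite oracles in $\mathbf{O}$ is Ramsey positive. -/

import Mathlib

namespace OracleSep

/-! ### Oracle Turing machines

A machine has one two-way infinite work tape, which initially holds the input, and a write-only
query tape, which is erased when the oracle is consulted.  An oracle is a set of binary strings. -/

/-- Tape symbols: the blank `none`, the two bits, and `k` auxiliary symbols. -/
abbrev Sym (k : ℕ) : Type := Option (Bool ⊕ Fin k)

/-- Instructions of a machine with `n` states and `k` auxiliary tape symbols. -/
inductive Instr (n k : ℕ) : Type
  /-- Write the symbol `s` in the scanned cell, move the head one cell in direction `d`, append the
  bit `b` to the query tape if `emit = some b` (leave the query tape alone if `emit = none`), and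
  go to state `q`. -/
  | work (s : Sym k) (d : Turing.Dir) (emit : Option Bool) (q : Fin n) : Instr n k
  /-- Ask the oracle about the string on the query tape, erase the query tape, and go to state
  `yes` or `no` according to the answer. -/
  | ask (yes no : Fin n) : Instr n k

/-- A nondeterministic oracle Turing machine: in state `q`, scanning symbol `s`, the instructions in
`δ q s` are applicable, and the machine halts if there is none. -/
structure OracleTM where
  numStates : ℕ
  numAux : ℕ
  start : Fin numStates
  accepting : Set (Fin numStates)
  δ : Fin numStates → Sym numAux → Set (Instr numStates numAux)

namespace OracleTM

/-- A machine is deterministic if at most one instruction is applicable in every situation. -/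
def IsDeterministic (M : OracleTM) : Prop := ∀ q s, (M.δ q s).Subsingleton

/-- Configurations: the state, the work tape (with its head), and the string on the query tape. -/
structure Cfg (M : OracleTM) where
  state : Fin M.numStates
  tape : Turing.Tape (Sym M.numAux)
  query : List Bool

/-- The initial configuration on input `x`: the head scans the first symbol of `x`. -/
def init (M : OracleTM) (x : List Bool) : M.Cfg where
  state := M.start
  tape := Turing.Tape.mk₁ (x.map fun b => (some (Sum.inl b) : Sym M.numAux))
  query := []

open Classical in
/-- The effect of an instruction on a configuration, relative to the oracle `A`. -/
noncomputable def exec (M : OracleTM) (A : Set (List Bool)) (c : M.Cfg) :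
    Instr M.numStates M.numAux → M.Cfg
  | .work s d emit q => ⟨q, (c.tape.write s).move d, c.query ++ emit.toList⟩
  | .ask yes no => ⟨if c.query ∈ A then yes else no, c.tape, []⟩

/-- One step of computation relative to the oracle `A`. -/
def Step (M : OracleTM) (A : Set (List Bool)) (c c' : M.Cfg) : Prop :=
  ∃ i ∈ M.δ c.state c.tape.head, c' = M.exec A c i

/-- There is a computation path of exactly `t` steps from `c` to `c'` relative to `A`. -/
def ReachesIn (M : OracleTM) (A : Set (List Bool)) : ℕ → M.Cfg → M.Cfg → Prop
  | 0, c, c' => c = c'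
  | t + 1, c, c' => ∃ d, M.Step A c d ∧ M.ReachesIn A t d c'

/-- A configuration in which the machine has halted in an accepting state. -/
def IsAccepting (M : OracleTM) (c : M.Cfg) : Prop :=
  M.δ c.state c.tape.head = ∅ ∧ c.state ∈ M.accepting

/-- The language of `M` relative to `A`: the inputs that have an accepting computation path. -/
def lang (M : OracleTM) (A : Set (List Bool)) : Set (List Bool) :=
  {x | ∃ t c, M.ReachesIn A t (M.init x) c ∧ M.IsAccepting c}

/-- `M` runs in polynomial time relative to `A`: there is a polynomial `p` such that on every
input `x` every computation path has at most `p(|x|)` steps. -/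
def PolyTime (M : OracleTM) (A : Set (List Bool)) : Prop :=
  ∃ p : Polynomial ℕ, ∀ x t c, M.ReachesIn A t (M.init x) c → t ≤ p.eval x.length

end OracleTM

/-! ### Relativized complexity classes -/

/-- The class `P^A`. -/
def P (A : Set (List Bool)) : Set (Set (List Bool)) :=
  {L | ∃ M : OracleTM, M.IsDeterministic ∧ M.PolyTime A ∧ M.lang A = L}

/-- The class `NP^A`. -/
def NP (A : Set (List Bool)) : Set (Set (List Bool)) :=
  {L | ∃ M : OracleTM, M.PolyTime A ∧ M.lang A = L}

/-- The class `coNP^A`: the languages whose complement is in `NP^A`. -/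
def coNP (A : Set (List Bool)) : Set (Set (List Bool)) :=
  {L | Lᶜ ∈ NP A}

/-- The oracles that separate `P` from `NP`. -/
def sepPNP : Set (Set (List Bool)) := {A | P A ≠ NP A}

/-- The oracles that separate `NP` from `coNP`. -/
def sepNPcoNP : Set (Set (List Bool)) := {A | NP A ≠ coNP A}

/-! ### The Ellentuck topology -/

/-- The space `[ω]^ω` of infinite sets of natural numbers. -/
def InfSets : Type := {S : Set ℕ // S.Infinite}

/-- The basic set `[a, A] = {S : S \ A = a and S \ a ⊆ A}`. -/
def ellentuckBasic (a A : Set ℕ) : Set InfSets := {S | S.1 \ A = a ∧ S.1 \ a ⊆ A}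

/-- The Ellentuck topology: it is generated by the sets `[a, A]` with `a` finite and `A` an
infinite set disjoint from `a`. -/
instance ellentuckTopology : TopologicalSpace InfSets :=
  TopologicalSpace.generateFrom
    {U | ∃ a A : Set ℕ, a.Finite ∧ A.Infinite ∧ Disjoint a A ∧ U = ellentuckBasic a A}

/-- Ramsey small: meager in the Ellentuck topology. -/
def RamseySmall (X : Set InfSets) : Prop := IsMeagre X

/-- Ramsey positive: not Ramsey small. -/
def RamseyPositive (X : Set InfSets) : Prop := ¬ RamseySmall X

/-- A set of oracles as a set of infinite subsets of `ω`, via the enumeration `e` of the strings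
(finite oracles are discarded). -/
def asInfSets (e : ℕ ≃ List Bool) (𝒪 : Set (Set (List Bool))) : Set InfSets :=
  {S | e '' S.1 ∈ 𝒪}

end OracleSep

/-! The core is an infinite set `H` of strings h 0, h 1, ... of rapidly growing length such that,
for every infinite K ⊆ `H`, the complement of `lengthLang K` is not in NP^K, although `lengthLang K`
is, by guessing. Each h n is chosen to defeat all machines of index below n and all subsets s of the
finite set F of earlier strings at once (`exists_next`). Such a machine either has no short witness
for accepting some 0^m with oracle s, where no string of length m will ever enter the oracle, or
accepts 0^|h n| through few queries that miss h n, so that adding h n goes unnoticed. Both errors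
survive in any K with K ∩ F = s and h n ∈ K, since later strings are too long to be queried.
Treating every s is what makes the result hereditary.

Ramsey positivity follows because the infinite subsets of `H` form a nonempty basic open set and the
Ellentuck space is Baire, by fusion. The inclusion in (3) is closure of P^A under complement. -/

open Filter

namespace OracleSep

/-! ### Determinism, and closure of `P` under complement -/

namespace OracleTM

theorem Step.eq_of_isDeterministic {M : OracleTM} (hM : M.IsDeterministic) {A : Set (List Bool)}
    {c d d' : M.Cfg} (h : M.Step A c d) (h' : M.Step A c d') : d = d' := by
  obtain ⟨i, hi, rfl⟩ := h
  obtain ⟨j, hj, rfl⟩ := h'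
  rw [hM _ _ hi hj]

theorem not_step_of_halted {M : OracleTM} {A : Set (List Bool)} {c d : M.Cfg}
    (hc : M.δ c.state c.tape.head = ∅) : ¬ M.Step A c d := by
  rintro ⟨i, hi, -⟩
  simp [hc] at hi

theorem ReachesIn.eq_of_halted {M : OracleTM} (hM : M.IsDeterministic) {A : Set (List Bool)}
    {t : ℕ} : ∀ {t' : ℕ} {c d d' : M.Cfg}, M.ReachesIn A t c d → M.ReachesIn A t' c d' →
      M.δ d.state d.tape.head = ∅ → M.δ d'.state d'.tape.head = ∅ → d = d' := by
  induction t with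
  | zero =>
    rintro (_ | t') c d d' h h' hd hd'
    · exact h.symm.trans h'
    · obtain rfl : c = d := h
      obtain ⟨e, he, -⟩ := h'
      exact (not_step_of_halted hd he).elim
  | succ t ih =>
    rintro (_ | t') c d d' h h' hd hd'
    · obtain rfl : c = d' := h'
      obtain ⟨e, he, -⟩ := h
      exact (not_step_of_halted hd' he).elim
    · obtain ⟨e, he, h⟩ := h
      obtain ⟨e', he', h'⟩ := h'
      obtain rfl := he.eq_of_isDeterministic hM he'
      exact ih h h' hd hd'

theorem ReachesIn.snoc {M : OracleTM} {A : Set (List Bool)} {t : ℕ} :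
    ∀ {c d d' : M.Cfg}, M.ReachesIn A t c d → M.Step A d d' → M.ReachesIn A (t + 1) c d' := by
  induction t with
  | zero =>
    intro c d d' h hs
    obtain rfl : c = d := h
    exact ⟨d', hs, rfl⟩
  | succ t ih =>
    rintro c d d' ⟨e, he, h⟩ hs
    exact ⟨e, he, ih h hs⟩

/-- A machine that runs in polynomial time has a halting computation path on every input. -/
theorem PolyTime.exists_halted {M : OracleTM} {A : Set (List Bool)} (h : M.PolyTime A)
    (x : List Bool) :
    ∃ t c, M.ReachesIn A t (M.init x) c ∧ M.δ c.state c.tape.head = ∅ := by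
  obtain ⟨p, hp⟩ := h
  by_contra! hcon
  -- If no path halts, paths extend to any length, beyond the time bound.
  have hlong : ∀ t, ∃ c, M.ReachesIn A t (M.init x) c := by
    intro t
    induction t with
    | zero => exact ⟨_, rfl⟩
    | succ t ih =>
      obtain ⟨c, hc⟩ := ih
      obtain ⟨i, hi⟩ := hcon t c hc
      exact ⟨_, hc.snoc ⟨i, hi, rfl⟩⟩
  obtain ⟨c, hc⟩ := hlong (p.eval x.length + 1)
  have := hp x _ c hc
  omega

/-- The machine with accepting and rejecting states interchanged. -/
abbrev flip (M : OracleTM) : OracleTM := { M with accepting := M.acceptingᶜ }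

/-- The two machines have different configuration types, so configurations are carried over field by
field. -/
theorem reachesIn_flip (M : OracleTM) (A : Set (List Bool)) (t : ℕ) :
    ∀ c d : M.Cfg, M.flip.ReachesIn A t ⟨c.state, c.tape, c.query⟩ ⟨d.state, d.tape, d.query⟩ ↔
      M.ReachesIn A t c d := by
  have hstep : ∀ c d : M.Cfg,
      M.flip.Step A ⟨c.state, c.tape, c.query⟩ ⟨d.state, d.tape, d.query⟩ ↔ M.Step A c d := by
    intro c d
    refine exists_congr fun i => and_congr Iff.rfl ?_
    cases d
    cases i <;> simp [exec]
  induction t with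
  | zero =>
    intro c d
    cases c
    cases d
    simp [ReachesIn]
  | succ t ih =>
    intro c d
    constructor
    · rintro ⟨⟨s, τ, q⟩, he, h⟩
      exact ⟨⟨s, τ, q⟩, (hstep c ⟨s, τ, q⟩).1 he, (ih ⟨s, τ, q⟩ d).1 h⟩
    · rintro ⟨e, he, h⟩
      exact ⟨⟨e.state, e.tape, e.query⟩, (hstep c e).2 he, (ih e d).2 h⟩

theorem reachesIn_flip_init (M : OracleTM) (A : Set (List Bool)) (t : ℕ) (x : List Bool)
    (d : M.Cfg) : M.flip.ReachesIn A t (M.flip.init x) ⟨d.state, d.tape, d.query⟩ ↔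
      M.ReachesIn A t (M.init x) d :=
  M.reachesIn_flip A t (M.init x) d

theorem PolyTime.flip {M : OracleTM} {A : Set (List Bool)} (h : M.PolyTime A) :
    M.flip.PolyTime A := by
  obtain ⟨p, hp⟩ := h
  refine ⟨p, ?_⟩
  rintro x t ⟨s, τ, q⟩ h
  exact hp x t ⟨s, τ, q⟩ ((M.reachesIn_flip_init A t x ⟨s, τ, q⟩).1 h)

theorem lang_flip {M : OracleTM} (hM : M.IsDeterministic) {A : Set (List Bool)}
    (h : M.PolyTime A) : M.flip.lang A = (M.lang A)ᶜ := by
  ext x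
  constructor
  · rintro ⟨t, ⟨s, τ, q⟩, hr, hh, ha⟩ ⟨t', c', hr', hh', ha'⟩
    have hr := (M.reachesIn_flip_init A t x ⟨s, τ, q⟩).1 hr
    obtain rfl := hr.eq_of_halted hM hr' hh hh'
    exact ha ha'
  · intro hx
    obtain ⟨t, c, hr, hh⟩ := h.exists_halted x
    exact ⟨t, ⟨c.state, c.tape, c.query⟩, (M.reachesIn_flip_init A t x c).2 hr, hh,
      fun ha => hx ⟨t, c, hr, hh, ha⟩⟩

end OracleTM

theorem compl_mem_P {A L : Set (List Bool)} (h : L ∈ P A) : Lᶜ ∈ P A := by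
  obtain ⟨M, hM, hp, rfl⟩ := h
  exact ⟨M.flip, hM, hp.flip, OracleTM.lang_flip hM hp⟩

theorem sepNPcoNP_subset_sepPNP : sepNPcoNP ⊆ sepPNP := by
  intro A hA hP
  refine hA (Set.ext fun L => ?_)
  change L ∈ NP A ↔ Lᶜ ∈ NP A
  rw [← hP]
  exact ⟨compl_mem_P, fun h => by simpa using compl_mem_P h⟩

/-! ### A language in `NP^A` -/

/-- The strings whose length is the length of some element of `A`. -/
def lengthLang (A : Set (List Bool)) : Set (List Bool) := {x | ∃ y ∈ A, y.length = x.length}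

/-- The machine that guesses a string of the length of its input and asks the oracle about it. -/
abbrev guessTM : OracleTM where
  numStates := 3
  numAux := 0
  start := 0
  accepting := {1}
  δ q s := if q = 0 then
      (if s = none then {Instr.ask 1 2} else {i | ∃ b, i = Instr.work s .right (some b) 0})
    else ∅

/-- The configuration in which `guessTM` scans the beginning of `x`. -/
def guessCfg (L : Turing.ListBlank (Sym 0)) (x w : List Bool) : guessTM.Cfg where
  state := (0 : Fin 3)
  tape := Turing.Tape.mk' L (Turing.ListBlank.mk (x.map fun b => (some (Sum.inl b) : Sym 0)))
  query := w

theorem guessTM_step_cons (A : Set (List Bool)) (L : Turing.ListBlank (Sym 0)) (a : Bool)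
    (x w : List Bool) (d : guessTM.Cfg) :
    guessTM.Step A (guessCfg L (a :: x) w) d ↔
      ∃ b, d = guessCfg (L.cons (some (Sum.inl a))) x (w ++ [b]) := by
  have hhead : (guessCfg L (a :: x) w).tape.head = some (Sum.inl a) := by
    simp [guessCfg]
  have hδ : guessTM.δ (guessCfg L (a :: x) w).state (guessCfg L (a :: x) w).tape.head =
      {i | ∃ b, i = Instr.work (some (Sum.inl a)) .right (some b) (0 : Fin 3)} := by
    rw [hhead]
    simp [guessTM, guessCfg]
  have hexec : ∀ b, guessTM.exec A (guessCfg L (a :: x) w)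
      (Instr.work (some (Sum.inl a)) .right (some b) (0 : Fin 3)) =
        guessCfg (L.cons (some (Sum.inl a))) x (w ++ [b]) := by
    intro b
    simp [OracleTM.exec, guessCfg]
  constructor
  · rintro ⟨i, hi, rfl⟩
    rw [hδ] at hi
    obtain ⟨b, rfl⟩ := hi
    exact ⟨b, hexec b⟩
  · rintro ⟨b, rfl⟩
    refine ⟨_, ?_, (hexec b).symm⟩
    rw [hδ]
    exact ⟨b, rfl⟩

theorem guessTM_δ_nil (L : Turing.ListBlank (Sym 0)) (w : List Bool) :
    guessTM.δ (guessCfg L [] w).state (guessCfg L [] w).tape.head =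
      {Instr.ask (1 : Fin 3) (2 : Fin 3)} := by
  have hhead : (guessCfg L [] w).tape.head = none := rfl
  rw [hhead]
  simp [guessTM, guessCfg]

open Classical in
theorem guessTM_step_nil (A : Set (List Bool)) (L : Turing.ListBlank (Sym 0)) (w : List Bool)
    (d : guessTM.Cfg) : guessTM.Step A (guessCfg L [] w) d ↔
      d = ⟨if w ∈ A then (1 : Fin 3) else (2 : Fin 3), (guessCfg L [] w).tape, []⟩ := by
  unfold OracleTM.Step
  rw [guessTM_δ_nil]
  simp [OracleTM.exec, guessCfg]

theorem guessTM_δ_of_ne_zero {q : Fin 3} (hq : q ≠ 0) (s : Sym 0) : guessTM.δ q s = ∅ :=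
  if_neg hq

theorem guessTM_reachesIn_le (A : Set (List Bool)) (x : List Bool) :
    ∀ L w t d, guessTM.ReachesIn A t (guessCfg L x w) d → t ≤ x.length + 1 := by
  classical
  induction x with
  | nil =>
    rintro L w (_ | _ | t) d h
    · simp
    · simp
    · obtain ⟨e, he, f, hf, -⟩ := h
      rw [guessTM_step_nil] at he
      subst he
      refine (OracleTM.not_step_of_halted (guessTM_δ_of_ne_zero ?_ _) hf).elim
      change (if w ∈ A then (1 : Fin 3) else 2) ≠ 0
      split_ifs <;> decide
  | cons a x ih =>
    rintro L w (_ | t) d h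
    · simp
    · obtain ⟨e, he, h⟩ := h
      rw [guessTM_step_cons] at he
      obtain ⟨b, rfl⟩ := he
      simpa using ih _ _ _ _ h

/-- The induction needs an arbitrary `w`: the part of the guess already on the query tape. -/
theorem guessTM_accepts_iff (A : Set (List Bool)) (x : List Bool) :
    ∀ L w, (∃ t c, guessTM.ReachesIn A t (guessCfg L x w) c ∧ guessTM.IsAccepting c) ↔
      ∃ y, y.length = x.length ∧ w ++ y ∈ A := by
  classical
  induction x with
  | nil =>
    intro L w
    constructor
    · rintro ⟨_ | _ | t, c, h, hh, ha⟩
      · obtain rfl : guessCfg L [] w = c := h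
        rw [guessTM_δ_nil] at hh
        simp at hh
      · obtain ⟨e, he, rfl⟩ := h
        rw [guessTM_step_nil] at he
        subst he
        refine ⟨[], rfl, ?_⟩
        by_contra hw
        rw [List.append_nil] at hw
        simp [hw, guessTM] at ha
      · have := guessTM_reachesIn_le A [] L w _ _ h
        simp at this
    · rintro ⟨y, hy, hw⟩
      obtain rfl : y = [] := by simpa using hy
      rw [List.append_nil] at hw
      refine ⟨1, ⟨(1 : Fin 3), (guessCfg L [] w).tape, []⟩, ⟨_, ?_, rfl⟩, ?_, ?_⟩
      · rw [guessTM_step_nil, if_pos hw]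
      · exact guessTM_δ_of_ne_zero one_ne_zero _
      · exact Set.mem_singleton _
  | cons a x ih =>
    intro L w
    constructor
    · rintro ⟨_ | t, c, h, hacc⟩
      · obtain rfl : guessCfg L (a :: x) w = c := h
        have := hacc.2
        simp [guessTM, guessCfg] at this
      · obtain ⟨e, he, h⟩ := h
        rw [guessTM_step_cons] at he
        obtain ⟨b, rfl⟩ := he
        obtain ⟨y, hy, hw⟩ := (ih _ _).1 ⟨t, c, h, hacc⟩
        exact ⟨b :: y, by simp [hy], by simpa using hw⟩
    · rintro ⟨_ | ⟨b, y⟩, hy, hw⟩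
      · simp at hy
      · obtain ⟨t, c, h, hacc⟩ := (ih (L.cons (some (Sum.inl a))) (w ++ [b])).2
          ⟨y, by simpa using hy, by simpa using hw⟩
        exact ⟨t + 1, c, ⟨_, (guessTM_step_cons A L a x w _).2 ⟨b, rfl⟩, h⟩, hacc⟩

theorem guessTM_init (x : List Bool) :
    guessTM.init x = guessCfg (Turing.ListBlank.mk []) x [] := rfl

theorem lengthLang_mem_NP (A : Set (List Bool)) : lengthLang A ∈ NP A := by
  refine ⟨guessTM, ⟨Polynomial.X + 1, fun x t c h => ?_⟩, Set.ext fun x => ?_⟩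
  · simpa using guessTM_reachesIn_le A x _ _ t c (guessTM_init x ▸ h)
  · change (∃ t c, guessTM.ReachesIn A t (guessTM.init x) c ∧ guessTM.IsAccepting c) ↔ _
    rw [guessTM_init, guessTM_accepts_iff]
    simp [lengthLang, and_comm]

/-! ### Oracle use of a computation path -/

/-- A computation path of `t` steps depends on the answers to at most `t` queries. -/
theorem OracleTM.ReachesIn.exists_use {M : OracleTM} {A : Set (List Bool)} {t : ℕ} :
    ∀ {c d : M.Cfg}, M.ReachesIn A t c d →
      ∃ Q : Finset (List Bool), Q.card ≤ t ∧ (∀ q ∈ Q, q.length ≤ c.query.length + t) ∧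
        ∀ B : Set (List Bool), (∀ q ∈ Q, q ∈ A ↔ q ∈ B) → M.ReachesIn B t c d := by
  classical
  induction t with
  | zero => exact fun h => ⟨∅, by simp, by simp, fun _ _ => h⟩
  | succ t ih =>
    rintro c d ⟨e, ⟨i, hi, rfl⟩, h⟩
    obtain ⟨Q, hcard, hlen, hQ⟩ := ih h
    cases i with
    | work s dir emit q =>
      refine ⟨Q, by omega, fun r hr => ?_, fun B hB => ⟨_, ⟨_, hi, rfl⟩, hQ B hB⟩⟩
      have := hlen r hr
      have hemit : emit.toList.length ≤ 1 := by cases emit <;> simp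
      simp only [OracleTM.exec, List.length_append] at this
      omega
    | ask yes no =>
      -- The query tape is erased here, so later queries have length at most `t`.
      refine ⟨insert c.query Q, (Finset.card_insert_le _ _).trans (by omega), ?_, ?_⟩
      · intro r hr
        rcases Finset.mem_insert.1 hr with rfl | hr
        · omega
        · have := hlen r hr
          simp only [OracleTM.exec, List.length_nil] at this
          omega
      · intro B hB
        refine ⟨_, ⟨_, hi, ?_⟩, hQ B fun q hq => hB q (Finset.mem_insert_of_mem hq)⟩
        simp only [OracleTM.exec, hB c.query (Finset.mem_insert_self _ _)]

/-- Relative to `A`, the machine `M` accepts `0 ^ m`, on the strength of at most `N` queries, all of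
them of length at most `N`. -/
def AcceptsZeros (M : OracleTM) (A : Set (List Bool)) (m N : ℕ) (Q : Finset (List Bool)) : Prop :=
  Q.card ≤ N ∧ (∀ q ∈ Q, q.length ≤ N) ∧
    ∀ B : Set (List Bool), (∀ q ∈ Q, q ∈ A ↔ q ∈ B) → List.replicate m false ∈ M.lang B

theorem AcceptsZeros.congr {M : OracleTM} {A B : Set (List Bool)} {m N : ℕ}
    {Q : Finset (List Bool)} (h : AcceptsZeros M A m N Q) (hAB : ∀ q ∈ Q, q ∈ A ↔ q ∈ B) :
    AcceptsZeros M B m N Q :=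
  ⟨h.1, h.2.1, fun C hC => h.2.2 C fun q hq => (hAB q hq).trans (hC q hq)⟩

/-- The time bound is used only here. `AcceptsZeros` carries its own bounds, so machines need no
clocks for other oracles. -/
theorem exists_acceptsZeros {M : OracleTM} {A : Set (List Bool)} {p : Polynomial ℕ}
    (hp : ∀ x t c, M.ReachesIn A t (M.init x) c → t ≤ p.eval x.length) {m : ℕ}
    (hm : List.replicate m false ∈ M.lang A) : ∃ Q, AcceptsZeros M A m (p.eval m) Q := by
  obtain ⟨t, c, hr, hc⟩ := hm
  have ht : t ≤ p.eval m := by simpa using hp _ _ _ hr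
  obtain ⟨Q, hcard, hlen, hQ⟩ := hr.exists_use
  refine ⟨Q, hcard.trans ht, fun q hq => (hlen q hq).trans ?_, fun B hB => ⟨t, c, hQ B hB, hc⟩⟩
  simpa [OracleTM.init] using ht

/-! ### Countability of the set of machines -/

instance (n k : ℕ) : Finite (Instr n k) := by
  let f : Instr n k → (Sym k × Turing.Dir × Option Bool × Fin n) ⊕ (Fin n × Fin n)
    | .work s d emit q => Sum.inl (s, d, emit, q)
    | .ask yes no => Sum.inr (yes, no)
  have : Finite Turing.Dir :=
    Finite.of_injective (fun d : Turing.Dir => decide (d = .left)) (by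
      rintro (_ | _) (_ | _) <;> simp)
  refine Finite.of_injective f ?_
  rintro (_ | _) (_ | _) h <;> simp_all [f]

instance : Countable OracleTM := by
  let f : OracleTM → Σ nk : ℕ × ℕ, Fin nk.1 × Set (Fin nk.1) ×
      (Fin nk.1 → Sym nk.2 → Set (Instr nk.1 nk.2)) :=
    fun M => ⟨(M.numStates, M.numAux), M.start, M.accepting, M.δ⟩
  refine Function.Injective.countable (f := f) ?_
  rintro ⟨n, k, s, a, δ⟩ ⟨n', k', s', a', δ'⟩ h
  simp only [f, Sigma.mk.injEq, Prod.mk.injEq] at h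
  obtain ⟨⟨rfl, rfl⟩, h⟩ := h
  simp only [heq_eq_eq, Prod.mk.injEq] at h
  obtain ⟨rfl, rfl, rfl⟩ := h
  rfl

theorem countable_natPolynomial : Countable (Polynomial ℕ) := by
  refine Function.Injective.countable
    (f := fun p : Polynomial ℕ => (List.range (p.natDegree + 1)).map p.coeff) fun p q h => ?_
  have hdeg : p.natDegree = q.natDegree := by simpa using congrArg List.length h
  refine Polynomial.ext fun n => ?_
  by_cases hn : n ≤ p.natDegree
  · simp only [hdeg, List.map_inj_left, List.mem_range] at h
    exact h n (by omega)
  · rw [Polynomial.coeff_eq_zero_of_natDegree_lt (by omega),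
      Polynomial.coeff_eq_zero_of_natDegree_lt (by omega)]

/-! ### Construction of the oracle -/

theorem eval_isLittleO_two_pow (p : Polynomial ℕ) :
    (fun n : ℕ => ((p.eval n : ℕ) : ℝ)) =o[atTop] fun n => (2 : ℝ) ^ n := by
  induction p using Polynomial.induction_on' with
  | add p q hp hq => simpa using hp.add hq
  | monomial k a =>
    simpa using (isLittleO_pow_const_const_pow_of_one_lt k (one_lt_two (α := ℝ))).const_mul_left
      (a : ℝ)

theorem eventually_eval_lt_two_pow (p : Polynomial ℕ) : ∀ᶠ n in atTop, p.eval n < 2 ^ n := by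
  filter_upwards [(eval_isLittleO_two_pow p).bound (c := 1 / 2) (by norm_num)] with n hn
  have h2 : (0 : ℝ) < 2 ^ n := by positivity
  simp only [Real.norm_natCast, norm_pow, Real.norm_ofNat] at hn
  have : ((p.eval n : ℕ) : ℝ) < ((2 ^ n : ℕ) : ℝ) := by
    push_cast
    linarith
  exact_mod_cast this

theorem exists_length_eq_notMem (l : ℕ) (Q : Finset (List Bool)) (hQ : Q.card < 2 ^ l) :
    ∃ h : List Bool, h.length = l ∧ h ∉ Q := by
  by_contra! hcon
  have hcard := Finset.card_le_card_of_injOn (s := (Finset.univ : Finset (List.Vector Bool l)))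
    (t := Q) (fun v => v.1) (fun v _ => hcon v.1 v.2) (fun v _ w _ h => Subtype.ext h)
  rw [Finset.card_univ, card_vector, Fintype.card_bool] at hcard
  omega

/-- One more string `h` is added to the finite set `F`: it decides for the first `n` machines and
for every subset `s` of `F` either that the machine errs on some `0 ^ m` which has no string of its
length in the oracle, or that it errs on `0 ^ |h|` when `h` is added to `s`. -/
theorem exists_next (M : ℕ → OracleTM) (p : ℕ → Polynomial ℕ) (n : ℕ) (F : Finset (List Bool)) :
    ∃ h : List Bool, (∀ x ∈ F, x.length < h.length) ∧
      (∀ x ∈ F, ∀ i < n, (p i).eval x.length < h.length) ∧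
      ∀ i < n, ∀ s ⊆ F,
        (∃ m, (∀ x ∈ F, x.length < m) ∧ m < h.length ∧ (p i).eval m < h.length ∧
          ¬ ∃ Q, AcceptsZeros (M i) s m ((p i).eval m) Q) ∨
        ∃ Q, h ∉ Q ∧ AcceptsZeros (M i) s h.length ((p i).eval h.length) Q := by
  classical
  set N := F.sup List.length
  have hNF : ∀ x ∈ F, x.length ≤ N := fun x hx => Finset.le_sup hx
  have hev : ∀ i ∈ Finset.range n, ∀ s ∈ F.powerset, ∀ᶠ l in atTop,
      (∃ m, N < m ∧ m < l ∧ (p i).eval m < l ∧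
        ¬ ∃ Q, AcceptsZeros (M i) s m ((p i).eval m) Q) ∨
      ∃ Q, AcceptsZeros (M i) s l ((p i).eval l) Q := by
    intro i _ s _
    -- One failing `m` serves all large `l`; without one, every `l > N` has a witness.
    by_cases hm : ∃ m, N < m ∧ ¬ ∃ Q, AcceptsZeros (M i) s m ((p i).eval m) Q
    · obtain ⟨m, hNm, hm⟩ := hm
      filter_upwards [eventually_gt_atTop m, eventually_gt_atTop ((p i).eval m)] with l h1 h2
      exact Or.inl ⟨m, hNm, h1, h2, hm⟩
    · push Not at hm
      filter_upwards [eventually_gt_atTop N] with l hl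
      exact Or.inr (hm l hl)
  have hev' := (eventually_all_finset _).2 fun i hi => (eventually_all_finset _).2 (hev i hi)
  have hlen : ∀ᶠ l in atTop, ∀ x ∈ F, x.length < l :=
    (eventually_all_finset _).2 fun x _ => eventually_gt_atTop _
  have hval : ∀ᶠ l in atTop, ∀ x ∈ F, ∀ i ∈ Finset.range n, (p i).eval x.length < l :=
    (eventually_all_finset _).2 fun x _ => (eventually_all_finset _).2 fun i _ =>
      eventually_gt_atTop _
  -- The double sum bounds the queries in all witnesses together; below 2^l, it leaves a string of
  -- length `l` unqueried.
  obtain ⟨l, hl, hl', hlen, hval⟩ := (hev'.and ((eventually_eval_lt_two_pow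
    (∑ i ∈ Finset.range n, ∑ _s ∈ F.powerset, p i)).and (hlen.and hval))).exists
  let Q (i : ℕ) (s : Finset (List Bool)) : Finset (List Bool) :=
    if hQ : ∃ Q, AcceptsZeros (M i) s l ((p i).eval l) Q then hQ.choose else ∅
  have hQ : ∀ i (s : Finset (List Bool)), (∃ Q, AcceptsZeros (M i) s l ((p i).eval l) Q) →
      AcceptsZeros (M i) s l ((p i).eval l) (Q i s) := by
    intro i s h
    simp only [Q, dif_pos h]
    exact h.choose_spec
  have hQcard : ∀ i s, (Q i s).card ≤ (p i).eval l := by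
    intro i s
    by_cases h : ∃ Q, AcceptsZeros (M i) s l ((p i).eval l) Q
    · exact (hQ i s h).1
    · simp [Q, dif_neg h]
  obtain ⟨h, rfl, hh⟩ := exists_length_eq_notMem l
    ((Finset.range n).biUnion fun i => F.powerset.biUnion fun s => Q i s) (by
      refine lt_of_le_of_lt (Finset.card_biUnion_le.trans (Finset.sum_le_sum fun i _ =>
        Finset.card_biUnion_le.trans (Finset.sum_le_sum fun s _ => hQcard i s))) ?_
      simpa only [Polynomial.eval_finsetSum] using hl')
  refine ⟨h, hlen, fun x hx i hi => hval x hx i (Finset.mem_range.2 hi), fun i hi s hs => ?_⟩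
  rcases hl i (Finset.mem_range.2 hi) s (Finset.mem_powerset.2 hs) with ⟨m, h1, h2⟩ | hA
  · exact Or.inl ⟨m, fun x hx => (hNF x hx).trans_lt h1, h2⟩
  · refine Or.inr ⟨Q i s, fun hmem => hh ?_, hQ i s hA⟩
    exact Finset.mem_biUnion.2 ⟨i, Finset.mem_range.2 hi,
      Finset.mem_biUnion.2 ⟨s, Finset.mem_powerset.2 hs, hmem⟩⟩

/-- There is an infinite oracle all of whose infinite subsets separate `NP` from `coNP`. -/
theorem exists_infinite_forall_NP_ne_coNP : ∃ H : Set (List Bool), H.Infinite ∧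
    ∀ K : Set (List Bool), K ⊆ H → K.Infinite → NP K ≠ coNP K := by
  classical
  have := countable_natPolynomial
  obtain ⟨enum, henum⟩ : ∃ f : ℕ → OracleTM × Polynomial ℕ, Function.Surjective f :=
    have : Nonempty (OracleTM × Polynomial ℕ) := ⟨(guessTM, 0)⟩
    exists_surjective_nat _
  choose g hglen hgval hgdec using exists_next (fun i => (enum i).1) (fun i => (enum i).2)
  let F : ℕ → Finset (List Bool) := fun n => Nat.rec ∅ (fun n S => insert (g n S) S) n
  let h : ℕ → List Bool := fun n => g n (F n)
  have hF : ∀ n, F n = (Finset.range n).image h := by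
    intro n
    induction n with
    | zero => rfl
    | succ n ih =>
      rw [Finset.range_add_one, Finset.image_insert, ← ih]
  have hmem : ∀ {j n}, j < n → h j ∈ F n := by
    intro j n hj
    rw [hF]
    exact Finset.mem_image_of_mem h (Finset.mem_range.2 hj)
  have hmono : StrictMono fun n => (h n).length := fun j n hj => hglen n (F n) _ (hmem hj)
  have hinj : Function.Injective h := fun i j hij =>
    hmono.injective (congrArg List.length hij)
  refine ⟨Set.range h, Set.infinite_range_of_injective hinj, fun K hKH hK hNP => ?_⟩
  have hL : lengthLang K ∈ coNP K := hNP ▸ lengthLang_mem_NP K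
  obtain ⟨M, ⟨p, hp⟩, hM⟩ := hL
  obtain ⟨i, hi⟩ := henum (M, p)
  -- Stage `n` both treats machine `i` and contributes to `K`.
  obtain ⟨n, hin, hn⟩ : ∃ n, i < n ∧ h n ∈ K := by
    by_contra! hcon
    refine hK (((Finset.range (i + 1)).image h).finite_toSet.subset fun x hx => ?_)
    obtain ⟨n, rfl⟩ := hKH hx
    have : n ≤ i := not_lt.1 fun hlt => hcon n hlt hx
    exact Finset.mem_coe.2 (Finset.mem_image_of_mem h (Finset.mem_range.2 (by omega)))
  have hshort : ∀ k, ∀ q ∈ K, q.length < (h k).length → ∃ j < k, h j = q := by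
    intro k q hq hlt
    obtain ⟨j, rfl⟩ := hKH hq
    exact ⟨j, hmono.lt_iff_lt.1 hlt, rfl⟩
  have hdec := hgdec n (F n) i hin ((F n).filter (· ∈ K)) (Finset.filter_subset _ _)
  simp only [hi] at hdec
  rcases hdec with ⟨m, hFm, hmh, hpm, hno⟩ | ⟨Q, hQ, hacc⟩
  · have hm : List.replicate m false ∈ M.lang K := by
      rw [hM]
      rintro ⟨y, hy, hym⟩
      rw [List.length_replicate] at hym
      obtain ⟨j, hj, rfl⟩ := hshort n y hy (hym ▸ hmh)
      exact (hFm _ (hmem hj)).ne hym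
    obtain ⟨Q, hQ⟩ := exists_acceptsZeros hp hm
    -- Queries are shorter than `h n`, and there `K` agrees with `K ∩ F n`.
    refine hno ⟨Q, hQ.congr fun q hq => ?_⟩
    simp only [Finset.coe_filter, Set.mem_ofPred_eq]
    refine ⟨fun hqK => ⟨?_, hqK⟩, fun hq => hq.2⟩
    obtain ⟨j, hj, rfl⟩ := hshort n q hqK ((hQ.2.1 q hq).trans_lt hpm)
    exact hmem hj
  · have hm : List.replicate (h n).length false ∈ M.lang K := by
      refine hacc.2.2 K fun q hq => ?_
      simp only [Finset.coe_filter, Set.mem_ofPred_eq]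
      refine ⟨fun hq => hq.2, fun hqK => ⟨?_, hqK⟩⟩
      -- Queries are shorter than `h (n + 1)`, so only `h n` could distinguish `K` from `K ∩ F n`,
      -- and it is not in `Q`.
      have hval := hgval (n + 1) (F (n + 1)) _ (hmem n.lt_succ_self) i (by omega)
      simp only [hi] at hval
      obtain ⟨j, hj, rfl⟩ := hshort (n + 1) q hqK ((hacc.2.1 q hq).trans_lt hval)
      rcases Nat.lt_succ_iff_lt_or_eq.1 hj with hj | rfl
      · exact hmem hj
      · exact (hQ hq).elim
    rw [hM] at hm
    exact hm ⟨h n, hn, by simp⟩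

/-! ### The Ellentuck topology is Baire -/

theorem isOpen_ellentuckBasic {a A : Set ℕ} (ha : a.Finite) (hA : A.Infinite)
    (h : Disjoint a A) : IsOpen (ellentuckBasic a A) :=
  TopologicalSpace.isOpen_generateFrom_of_mem ⟨a, A, ha, hA, h, rfl⟩

theorem mem_ellentuckBasic_iff {a A : Set ℕ} (h : Disjoint a A) {S : InfSets} :
    S ∈ ellentuckBasic a A ↔ a ⊆ S.1 ∧ S.1 ⊆ a ∪ A := by
  rw [Set.disjoint_left] at h
  constructor
  · rintro ⟨h1, h2⟩
    refine ⟨h1 ▸ Set.sdiff_subset, fun x hx => ?_⟩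
    by_cases hxa : x ∈ a
    · exact Or.inl hxa
    · exact Or.inr (h2 ⟨hx, hxa⟩)
  · rintro ⟨h1, h2⟩
    refine ⟨Set.Subset.antisymm (fun x hx => (h2 hx.1).resolve_right hx.2)
      fun x hx => ⟨h1 hx, h hx⟩, fun x hx => (h2 hx.1).resolve_left hx.2⟩

/-- Open sets in the Ellentuck topology: a neighbourhood of `S` contains all infinite sets between
some finite `a ⊆ S` and `S`. -/
theorem exists_finite_of_isOpen {U : Set InfSets} (hU : IsOpen U) :
    ∀ S ∈ U, ∃ a : Set ℕ, a.Finite ∧ a ⊆ S.1 ∧ ∀ T : InfSets, a ⊆ T.1 → T.1 ⊆ S.1 → T ∈ U := by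
  induction hU with
  | basic V hV =>
    obtain ⟨a, A, ha, -, hd, rfl⟩ := hV
    intro S hS
    rw [mem_ellentuckBasic_iff hd] at hS
    exact ⟨a, ha, hS.1, fun T h1 h2 => (mem_ellentuckBasic_iff hd).2 ⟨h1, h2.trans hS.2⟩⟩
  | univ => exact fun S _ => ⟨∅, Set.finite_empty, Set.empty_subset _, fun _ _ _ => trivial⟩
  | inter V W _ _ ihV ihW =>
    rintro S ⟨hV, hW⟩
    obtain ⟨a, ha, haS, hTa⟩ := ihV S hV
    obtain ⟨b, hb, hbS, hTb⟩ := ihW S hW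
    exact ⟨a ∪ b, ha.union hb, Set.union_subset haS hbS, fun T h1 h2 =>
      ⟨hTa T (Set.subset_union_left.trans h1) h2, hTb T (Set.subset_union_right.trans h1) h2⟩⟩
  | sUnion 𝒱 _ ih =>
    rintro S ⟨V, hV, hS⟩
    obtain ⟨a, ha, haS, hT⟩ := ih V hV S hS
    exact ⟨a, ha, haS, fun T h1 h2 => ⟨V, hV, hT T h1 h2⟩⟩

/-- Given a finite `a ⊆ S`, a dense open set contains all infinite sets between `a'` and `S'` for
suitable `a ⊂ a' ⊆ S' ⊆ S` with `a'` finite. -/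
theorem exists_refinement {D : Set InfSets} (hDo : IsOpen D) (hD : Dense D) {a : Set ℕ}
    (ha : a.Finite) (S : InfSets) (haS : a ⊆ S.1) :
    ∃ (a' : Set ℕ) (S' : InfSets), a'.Finite ∧ a ⊂ a' ∧ a' ⊆ S'.1 ∧ S'.1 ⊆ S.1 ∧
      ∀ T : InfSets, a' ⊆ T.1 → T.1 ⊆ S'.1 → T ∈ D := by
  have hd : Disjoint a (S.1 \ a) := Set.disjoint_sdiff_right
  have hopen := isOpen_ellentuckBasic ha (S.2.sdiff ha) hd
  obtain ⟨S', hS'b, hS'D⟩ := hD.inter_open_nonempty _ hopen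
    ⟨S, (mem_ellentuckBasic_iff hd).2
      ⟨haS, by rw [Set.union_sdiff_self]; exact Set.subset_union_right⟩⟩
  rw [mem_ellentuckBasic_iff hd, Set.union_sdiff_self, Set.union_eq_self_of_subset_left haS] at hS'b
  obtain ⟨b, hb, hbS, hbT⟩ := exists_finite_of_isOpen hDo S' hS'D
  -- The extra point makes the finite part grow strictly, so that the fusion is infinite.
  obtain ⟨x, hxS, hxa⟩ := (S'.2.sdiff ha).nonempty
  refine ⟨insert x (a ∪ b), S', (ha.union hb).insert x, ?_,
    Set.insert_subset hxS (Set.union_subset hS'b.1 hbS), hS'b.2, fun T h1 h2 => hbT T ?_ h2⟩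
  · refine ⟨fun y hy => Or.inr (Or.inl hy), fun h => hxa (h (Set.mem_insert _ _))⟩
  · exact fun y hy => h1 (Or.inr (Or.inr hy))

instance : BaireSpace InfSets := by
  refine ⟨fun D hDo hD => dense_iff_inter_open.2 fun U hU hne => ?_⟩
  obtain ⟨S₀, hS₀⟩ := hne
  obtain ⟨a₀, ha₀, ha₀S, hT₀⟩ := exists_finite_of_isOpen hU S₀ hS₀
  choose a' S' hfin hss haS hSS hin using
    fun n (c : {c : Set ℕ × InfSets // c.1.Finite ∧ c.1 ⊆ c.2.1}) =>
      exists_refinement (hDo n) (hD n) c.2.1 c.1.2 c.2.2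
  -- Fusion: finite parts increase and infinite sets decrease; the union of the finite parts lies
  -- between the two at every stage.
  let c : ℕ → {c : Set ℕ × InfSets // c.1.Finite ∧ c.1 ⊆ c.2.1} := fun n =>
    Nat.rec ⟨(a₀, S₀), ha₀, ha₀S⟩ (fun n c => ⟨(a' n c, S' n c), hfin n c, haS n c⟩) n
  have hmono : StrictMono fun n => (c n).1.1 := strictMono_nat_of_lt_succ fun n => hss n (c n)
  have hanti : Antitone fun n => (c n).1.2.1 := antitone_nat_of_succ_le fun n => hSS n (c n)
  have hinf : (⋃ n, (c n).1.1).Infinite := fun hf =>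
    Set.infinite_range_of_injective hmono.injective
      (hf.finite_subsets.subset (Set.range_subset_iff.2 fun n =>
        Set.subset_iUnion (fun n => (c n).1.1) n))
  have hsub : ∀ n, (⋃ n, (c n).1.1) ⊆ (c n).1.2.1 := fun n => Set.iUnion_subset fun k =>
    (hmono.monotone (le_max_left k n)).trans
      ((c (max k n)).2.2.trans (hanti (le_max_right k n)))
  have hsup : ∀ n, (c n).1.1 ⊆ ⋃ n, (c n).1.1 := Set.subset_iUnion fun n => (c n).1.1
  exact ⟨⟨_, hinf⟩, hT₀ _ (hsup 0) (hsub 0), Set.mem_iInter.2 fun n =>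
    hin n (c n) _ (hsup (n + 1)) (hsub (n + 1))⟩

/-- A family of infinite oracles that contains all infinite subsets of some infinite set is
Ramsey positive. -/
theorem ramseyPositive_of_forall_subset (e : ℕ ≃ List Bool) {𝒪 : Set (Set (List Bool))}
    {H : Set (List Bool)} (hH : H.Infinite)
    (h : ∀ K : Set (List Bool), K ⊆ H → K.Infinite → K ∈ 𝒪) :
    RamseyPositive (asInfSets e 𝒪) := by
  have hinf : (e ⁻¹' H).Infinite := hH.preimage (by simp)
  have hd : Disjoint ∅ (e ⁻¹' H) := Set.empty_disjoint _
  intro hmeagre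
  refine not_isMeagre_of_isOpen (isOpen_ellentuckBasic Set.finite_empty hinf hd)
    ⟨⟨_, hinf⟩, (mem_ellentuckBasic_iff hd).2 ⟨Set.empty_subset _, Set.subset_union_right⟩⟩
    (IsMeagre.mono (fun S hS => ?_) hmeagre)
  rw [mem_ellentuckBasic_iff hd, Set.empty_union] at hS
  exact h _ (Set.image_subset_iff.2 hS.2) (S.2.image e.injective.injOn)

end OracleSep

theorem mainTheorem1 (e : ℕ ≃ List Bool) :
    OracleSep.RamseyPositive (OracleSep.asInfSets e OracleSep.sepNPcoNP) ∧
    (∃ H : Set (List Bool), H.Infinite ∧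
      ∀ K : Set (List Bool), K ⊆ H → K.Infinite → OracleSep.NP K ≠ OracleSep.coNP K) ∧
    OracleSep.sepNPcoNP ⊆ OracleSep.sepPNP ∧
    OracleSep.RamseyPositive (OracleSep.asInfSets e OracleSep.sepPNP) := by
  obtain ⟨H, hH, hK⟩ := OracleSep.exists_infinite_forall_NP_ne_coNP
  exact ⟨OracleSep.ramseyPositive_of_forall_subset e hH hK, ⟨H, hH, hK⟩,
    OracleSep.sepNPcoNP_subset_sepPNP,
    OracleSep.ramseyPositive_of_forall_subset e hH fun K h1 h2 =>
      OracleSep.sepNPcoNP_subset_sepPNP (hK K h1 h2)⟩
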